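/- Let $\mathcal H$ be a complex separable Hilbert space and let $H\subset\mathcal H$ be a standard subspace, i.e. a closed real-linear subspace with $H\cap iH=\{0\}$ and $H+iH$ dense in $\mathcal H$. Let $H'=\{v\in\mathcal H:\operatorname{Im}\langle v,h\rangle=0\ \forall h\in H\}$ denote the symplectic complement (and similarly for other real subspaces), let ${}^{\perp_{\mathbb R}}$ denote the orthogonal complement with respect to $\operatorname{Re}\langle\cdot,\cdot\rangle$, and let $\dim$ be the real dimension. Let $J_H$ be the antiunitary part of the polar decomposition $S_H=J_H\Delta_H^{1/2}$ of the Tomita operator $S_H:H+iH\to H+iH$, $h_1+ih_2\mapsto h_1-ih_2$. A unitary $U$ on $\mathcal H$ is called symmetric if $U=J_HU^*J_H$; it is called an endomorphism of $H$ if $UH\subset H$, and a proper endomorphism if $UH\subsetneq H$. $H$ is called a factor if $H\cap H'=\{0\}$. (a) If $U_1,\dots,U_n$ are symmetric proper endomorphisms of $H$ and $U=U_1\cdots U_n$, then $\dim\big((UH)^{\perp_{\mathbb R}}\cap H\big)\ge n$. (b) If $H$ is a factor, each $U_j$ ($j=1,\dots,n$) is the square of a symmetric endomorphism of $H$, $U_jH\ne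 H$ for all $j$, and $U=U_1\cdots U_n$, then $\dim\big((UH)'\cap H\big)\ge n$. (c) If $(U(x))_{x\in\mathbb R}$ is a one-parameter group of symmetric unitaries (that is, $U(x+y)=U(x)U(y)$ for all $x,y\in\mathbb R$) such that $U(x)H\subsetneq H$ for all $x>0$, then $\dim\big(U(x)H'\cap H\big)=\infty$ for every $x>0$. -/

import Mathlib

open ClosedSubmodule
open scoped ComplexInnerProductSpace

namespace StandardSubspace
variable {E : Type*} [NormedAddCommGroup E] [InnerProductSpace ℂ E]

/-- The identity on `H` and minus the identity on `iH` agree on `H ∩ iH = {0}`. -/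
theorem tomita_aux (H : StandardSubspace E)
    (x : (LinearPMap.mk (σ := RingHom.id ℝ) H.toClosedSubmodule.toSubmodule
      H.toClosedSubmodule.toSubmodule.subtype).domain)
    (y : (LinearPMap.mk (σ := RingHom.id ℝ) H.toClosedSubmodule.mulI.toSubmodule
      (-H.toClosedSubmodule.mulI.toSubmodule.subtype)).domain) (h : (x : E) = y) :
    (LinearPMap.mk (σ := RingHom.id ℝ) H.toClosedSubmodule.toSubmodule
      H.toClosedSubmodule.toSubmodule.subtype) x =
    (LinearPMap.mk (σ := RingHom.id ℝ) H.toClosedSubmodule.mulI.toSubmodule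
      (-H.toClosedSubmodule.mulI.toSubmodule.subtype)) y := by
  have hx : (x : E) ∈ H.toClosedSubmodule ⊓ H.toClosedSubmodule.mulI := ⟨x.2, h ▸ y.2⟩
  rw [H.IsSeparating, ClosedSubmodule.mem_bot] at hx
  have hy : (y : E) = 0 := h ▸ hx
  change (x : E) = -(y : E)
  simp [hx, hy]

/-- The Tomita operator `S_H : H + iH → H + iH`, `h₁ + i h₂ ↦ h₁ - i h₂`, as a densely defined
(real-linear, in fact antilinear) operator: the identity on `H` and minus the identity on `iH`. -/
noncomputable def tomita (H : StandardSubspace E) : E →ₗ.[ℝ] E :=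
  LinearPMap.sup ⟨H.toClosedSubmodule.toSubmodule, H.toClosedSubmodule.toSubmodule.subtype⟩
    ⟨H.toClosedSubmodule.mulI.toSubmodule, -H.toClosedSubmodule.mulI.toSubmodule.subtype⟩
    H.tomita_aux

theorem mem_mulI_iff (H : ClosedSubmodule ℝ E) {x : E} :
    x ∈ H.mulI ↔ Complex.I • x ∈ H := by
  rw [ClosedSubmodule.mem_mapEquiv_iff, scalarSMulCLE_symm_apply, Units.smul_def,
    ← ClosedSubmodule.mem_toSubmodule_iff, ← neg_mem_iff]
  simp

theorem mem_tomita_graph (H : StandardSubspace E) {u v : E} : (u, v) ∈ H.tomita.graph ↔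
    ∃ h ∈ H.toClosedSubmodule, ∃ k ∈ H.toClosedSubmodule.mulI, u = h + k ∧ v = h - k := by
  have key : ∀ (h k : E) (hh : h ∈ H.toClosedSubmodule) (hk : k ∈ H.toClosedSubmodule.mulI)
      (z : H.tomita.domain), h + k = z → H.tomita z = h - k := by
    intro h k hh hk z hz
    refine (LinearPMap.sup_apply H.tomita_aux ⟨h, hh⟩ ⟨k, hk⟩ z hz).trans ?_
    change h + -k = _
    abel
  rw [LinearPMap.mem_graph_iff]
  constructor
  · rintro ⟨z, rfl, hz⟩
    obtain ⟨h, hh, k, hk, hz'⟩ := Submodule.mem_sup.1 z.2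
    exact ⟨h, hh, k, hk, hz'.symm, hz.symm.trans <| key h k hh hk z hz'⟩
  · rintro ⟨h, hh, k, hk, rfl, rfl⟩
    exact ⟨⟨h + k, Submodule.add_mem_sup hh hk⟩, rfl, key h k hh hk _ rfl⟩

theorem cplx_smul (c : ℂ) (x : E) : c • x = c.re • x + c.im • Complex.I • x := by
  conv_lhs => rw [← Complex.re_add_im c]
  rw [add_smul, mul_smul]; rfl

theorem isPositive_of_re (T : E →L[ℂ] E) (hs : ∀ x y, (⟪T x, y⟫).re = (⟪x, T y⟫).re)
    (hp : ∀ x, 0 ≤ (⟪T x, x⟫).re) : 0 ≤ T := by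
  rw [ContinuousLinearMap.nonneg_iff_isPositive]
  refine ⟨fun x y => ?_, hp⟩
  apply Complex.ext
  · exact hs x y
  · have := hs (Complex.I • x) y
    rw [map_smul, inner_smul_left, inner_smul_left] at this
    simpa using this

/-- The image `U K` of a closed real subspace `K` under a unitary `U`. -/
noncomputable def unitaryImage (U : E ≃ₗᵢ[ℂ] E) (K : ClosedSubmodule ℝ E) : ClosedSubmodule ℝ E :=
  K.mapEquiv (U.toContinuousLinearEquiv.restrictScalars ℝ)

/-- `U` belongs to the endomorphism semigroup of `H`: it is a unitary with `U H ⊆ H`. -/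
def IsEndomorphism (H : StandardSubspace E) (U : E ≃ₗᵢ[ℂ] E) : Prop :=
  unitaryImage U H.toClosedSubmodule ≤ H.toClosedSubmodule

/-- A proper endomorphism of `H`: a unitary with `U H ⊊ H`. -/
def IsProperEndomorphism (H : StandardSubspace E) (U : E ≃ₗᵢ[ℂ] E) : Prop :=
  unitaryImage U H.toClosedSubmodule < H.toClosedSubmodule

variable [CompleteSpace E]

/-- `S_H = J A` is the polar decomposition of the Tomita operator: `A` (which is `Δ_H^{1/2}`) is a
positive selfadjoint operator, `J` is antiunitary, and `S_H = J ∘ A` including domains. -/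
structure IsModularPair (H : StandardSubspace E) (J : E ≃ₗᵢ⋆[ℂ] E) (A : E →ₗ.[ℂ] E) : Prop where
  isSelfAdjoint : IsSelfAdjoint A
  nonneg : ∀ x : A.domain, 0 ≤ (⟪(x : E), A x⟫).re
  graph_eq : ∀ x y : E, (x, y) ∈ H.tomita.graph ↔ ∃ z, (x, z) ∈ A.graph ∧ y = J z

/-- The real orthogonal projection onto `K`. -/
noncomputable def proj (K : ClosedSubmodule ℝ E) : E →L[ℝ] E :=
  K.toSubmodule.starProjection

theorem proj_mem (K : ClosedSubmodule ℝ E) (x : E) : proj K x ∈ K :=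
  K.toSubmodule.starProjection_apply_mem x

theorem proj_eq (K : ClosedSubmodule ℝ E) {x : E} (hx : x ∈ K) : proj K x = x :=
  Submodule.starProjection_eq_self_iff.2 hx

theorem proj_symm (K : ClosedSubmodule ℝ E) (x y : E) :
    (⟪proj K x, y⟫).re = (⟪x, proj K y⟫).re :=
  Submodule.inner_starProjection_left_eq_right K.toSubmodule x y

theorem proj_unique (K : ClosedSubmodule ℝ E) {x y : E} (hy : y ∈ K)
    (h : ∀ w ∈ K, (⟪x - y, w⟫).re = 0) : proj K x = y :=
  (Submodule.eq_starProjection_of_mem_of_inner_eq_zero hy h)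

theorem proj_sub (K : ClosedSubmodule ℝ E) (x : E) {w : E} (hw : w ∈ K) :
    (⟪x - proj K x, w⟫).re = 0 :=
  Submodule.starProjection_inner_eq_zero x w hw

theorem proj_mulI (K : ClosedSubmodule ℝ E) (x : E) :
    proj K.mulI (Complex.I • x) = Complex.I • proj K x := by
  apply proj_unique
  · rw [mem_mulI_iff, smul_smul, Complex.I_mul_I, neg_smul, one_smul,
      ← ClosedSubmodule.mem_toSubmodule_iff, neg_mem_iff]
    exact proj_mem K x
  · intro w hw
    rw [mem_mulI_iff] at hw
    have := proj_sub K x hw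
    rw [← smul_sub, inner_smul_left]
    rw [inner_smul_right] at this
    simpa using this

theorem proj_I (K : ClosedSubmodule ℝ E) (x : E) :
    proj K (Complex.I • x) = Complex.I • proj K.mulI x := by
  have := proj_mulI K.mulI x
  rwa [mulI_mulI_eq] at this

/-- The sum of the real projections onto `K` and `iK`; it is complex linear. -/
noncomputable def sumProj (K : ClosedSubmodule ℝ E) : E →L[ℂ] E where
  toFun x := proj K x + proj K.mulI x
  map_add' x y := by simp only [map_add]; abel
  map_smul' c x := by
    rw [cplx_smul c x]
    simp only [map_add, map_smul, proj_mulI, RingHom.id_apply]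
    rw [proj_I, cplx_smul c]
    simp only [smul_add]; abel
  cont := by fun_prop

/-- The difference of the real projections onto `K` and `iK`; it is antilinear. -/
noncomputable def diffProj (K : ClosedSubmodule ℝ E) : E →ₗ⋆[ℂ] E where
  toFun x := proj K x - proj K.mulI x
  map_add' x y := by simp only [map_add]; abel
  map_smul' c x := by
    rw [cplx_smul c x]
    simp only [map_add, map_smul, proj_mulI]
    rw [proj_I, cplx_smul (starRingEnd ℂ c)]
    simp only [smul_sub, Complex.conj_re, Complex.conj_im, neg_smul]; abel

theorem sumProj_apply (K : ClosedSubmodule ℝ E) (x : E) :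
    sumProj K x = proj K x + proj K.mulI x := rfl
theorem diffProj_apply (K : ClosedSubmodule ℝ E) (x : E) :
    diffProj K x = proj K x - proj K.mulI x := rfl

theorem diffProj_diffProj (K : ClosedSubmodule ℝ E) (x : E) :
    diffProj K (diffProj K x) = sumProj K ((2 : ℂ) • x - sumProj K x) := by
  simp only [diffProj_apply, sumProj_apply, map_sub, map_add, two_smul]
  simp only [proj_eq K (proj_mem K x), proj_eq K.mulI (proj_mem K.mulI x)]
  abel

theorem diffProj_symm (K : ClosedSubmodule ℝ E) (x y : E) :
    (⟪diffProj K x, y⟫).re = (⟪x, diffProj K y⟫).re := by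
  simp only [diffProj_apply, inner_sub_left, inner_sub_right, Complex.sub_re, proj_symm]

theorem re_proj (K : ClosedSubmodule ℝ E) (x : E) : (⟪proj K x, x⟫).re = ‖proj K x‖ ^ 2 := by
  rw [← proj_eq K (proj_mem K x), proj_symm, proj_eq K (proj_mem K x)]
  exact (norm_sq_eq_re_inner (𝕜 := ℂ) _).symm

theorem sumProj_nonneg (K : ClosedSubmodule ℝ E) : 0 ≤ sumProj K := by
  apply isPositive_of_re
  · intro x y
    simp only [sumProj_apply, inner_add_left, inner_add_right, Complex.add_re, proj_symm]
  · intro x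
    rw [sumProj_apply, inner_add_left, Complex.add_re, re_proj, re_proj]
    positivity

theorem norm_proj_le (K : ClosedSubmodule ℝ E) (x : E) : ‖proj K x‖ ≤ ‖x‖ :=
  Submodule.norm_starProjection_apply_le _ x

theorem two_sub_apply (K : ClosedSubmodule ℝ E) (x : E) :
    ((2 : ℂ) • (1 : E →L[ℂ] E) - sumProj K) x = (2 : ℂ) • x - sumProj K x := by
  simp

theorem two_sub_nonneg (K : ClosedSubmodule ℝ E) :
    0 ≤ (2 : ℂ) • (1 : E →L[ℂ] E) - sumProj K := by
  apply isPositive_of_re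
  · intro x y
    rw [two_sub_apply, two_sub_apply]
    simp only [two_smul, sumProj_apply, inner_sub_left, inner_sub_right, inner_add_left,
      inner_add_right, Complex.add_re, Complex.sub_re, proj_symm]
  · intro x
    rw [two_sub_apply, sumProj_apply, two_smul]
    simp only [inner_sub_left, inner_add_left, Complex.add_re, Complex.sub_re, re_proj]
    have h1 := norm_proj_le K x
    have h2 := norm_proj_le K.mulI x
    have h3 : (⟪x, x⟫).re = ‖x‖ ^ 2 := (norm_sq_eq_re_inner (𝕜 := ℂ) _).symm
    rw [h3]
    have := norm_nonneg (proj K x)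
    have := norm_nonneg (proj K.mulI x)
    nlinarith

theorem eq_zero_of_proj (H : StandardSubspace E) {x : E}
    (h1 : proj H.toClosedSubmodule x = 0) (h2 : proj H.toClosedSubmodule.mulI x = 0) : x = 0 := by
  have h3 : x ∈ H.toClosedSubmoduleᗮ ⊓ H.toClosedSubmodule.mulIᗮ := by
    constructor
    · exact (Submodule.mem_orthogonal' _ _).2 fun u hu => by
        have := proj_sub _ x hu
        rwa [h1, sub_zero] at this
    · exact (Submodule.mem_orthogonal' _ _).2 fun u hu => by
        have := proj_sub _ x hu
        rwa [h2, sub_zero] at this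
  rw [ClosedSubmodule.inf_orthogonal, H.IsCyclic] at h3
  have := (Submodule.mem_orthogonal _ _).1 h3 x trivial
  exact inner_self_eq_zero.1 this

theorem sumProj_injective (H : StandardSubspace E) {x : E}
    (h : sumProj H.toClosedSubmodule x = 0) : x = 0 := by
  have h0 : (⟪sumProj H.toClosedSubmodule x, x⟫).re = 0 := by simp [h]
  rw [sumProj_apply, inner_add_left, Complex.add_re, re_proj, re_proj] at h0
  have := norm_nonneg (proj H.toClosedSubmodule x)
  apply H.eq_zero_of_proj
  · rw [← norm_eq_zero, ← sq_eq_zero_iff]; 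
    nlinarith [sq_nonneg ‖proj H.toClosedSubmodule.mulI x‖,
      sq_nonneg ‖proj H.toClosedSubmodule x‖]
  · rw [← norm_eq_zero, ← sq_eq_zero_iff]; 
    nlinarith [sq_nonneg ‖proj H.toClosedSubmodule.mulI x‖,
      sq_nonneg ‖proj H.toClosedSubmodule x‖]

theorem diffProj_injective (H : StandardSubspace E) {x : E}
    (h : diffProj H.toClosedSubmodule x = 0) : x = 0 := by
  rw [diffProj_apply, sub_eq_zero] at h
  have h1 : proj H.toClosedSubmodule x ∈ H.toClosedSubmodule ⊓ H.toClosedSubmodule.mulI :=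
    ⟨proj_mem _ _, h ▸ proj_mem _ _⟩
  rw [H.IsSeparating, ClosedSubmodule.mem_bot] at h1
  exact H.eq_zero_of_proj h1 (h ▸ h1)

theorem two_sub_injective (H : StandardSubspace E) {x : E}
    (h : (2 : ℂ) • x - sumProj H.toClosedSubmodule x = 0) : x = 0 := by
  apply H.diffProj_injective
  apply H.diffProj_injective
  rw [diffProj_diffProj, h, map_zero]

theorem dense_of_symm (f : E → E) (T : Submodule ℝ E) (hT : ∀ x, f x ∈ T)
    (hs : ∀ x y, (⟪f x, y⟫).re = (⟪x, f y⟫).re) (hi : ∀ x, f x = 0 → x = 0) :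
    Dense (T : Set E) := by
  rw [Submodule.dense_iff_topologicalClosure_eq_top, Submodule.topologicalClosure_eq_top_iff,
    Submodule.eq_bot_iff]
  intro x hx
  apply hi
  have h := (Submodule.mem_orthogonal _ _).1 hx (f (f x)) (hT _)
  rw [inner_real_eq_re_inner, hs] at h
  exact inner_self_eq_zero (𝕜 := ℝ).1 h

/-- The Tomita operator of a standard subspace has a polar decomposition. -/
theorem exists_isModularPair (H : StandardSubspace E) : ∃ J A, H.IsModularPair J A := by
  set K := H.toClosedSubmodule with hK
  set R := sumProj K with hR
  set R2 := (2 : ℂ) • (1 : E →L[ℂ] E) - R with hR2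
  set D := diffProj K with hD
  have hRp : 0 ≤ R := sumProj_nonneg K
  have hR2p : 0 ≤ R2 := two_sub_nonneg K
  have hR2a (x : E) : R2 x = (2 : ℂ) • x - R x := two_sub_apply K x
  set a := CFC.sqrt R with ha
  set b := CFC.sqrt R2 with hb
  have haa (x : E) : a (a x) = R x := congr($(CFC.sqrt_mul_sqrt_self R) x)
  have hbb (x : E) : b (b x) = R2 x := congr($(CFC.sqrt_mul_sqrt_self R2) x)
  have hcomm : Commute a b := by
    have h1 : Commute R R2 :=
      ((Commute.one_right R).smul_right _).sub_right (Commute.refl R)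
    have h2 : Commute a R2 := h1.cfcₙ_nnreal _
    exact (h2.symm.cfcₙ_nnreal _).symm
  have hab (x : E) : a (b x) = b (a x) := congr($hcomm.eq x)
  have has (x y : E) : ⟪a x, y⟫ = ⟪x, a y⟫ :=
    ((ContinuousLinearMap.nonneg_iff_isPositive a).1 (CFC.sqrt_nonneg R)).1 x y
  have hbs (x y : E) : ⟪b x, y⟫ = ⟪x, b y⟫ :=
    ((ContinuousLinearMap.nonneg_iff_isPositive b).1 (CFC.sqrt_nonneg R2)).1 x y
  have hT_pos : 0 ≤ a * b := hcomm.mul_nonneg (CFC.sqrt_nonneg R) (CFC.sqrt_nonneg R2)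
  have hai (x : E) (h : a x = 0) : x = 0 :=
    H.sumProj_injective (by rw [← hK, ← hR, ← haa, h, map_zero])
  have hbi (x : E) (h : b x = 0) : x = 0 :=
    H.two_sub_injective (by rw [← hK, ← hR, ← hR2a, ← hbb, h, map_zero])
  have hDD (x : E) : D (D x) = R (R2 x) := by rw [hR2a]; exact diffProj_diffProj K x
  have hDs (x y : E) : (⟪D x, y⟫).re = (⟪x, D y⟫).re := diffProj_symm K x y
  set T : E →L[ℂ] E := a * b with hT
  have hTa (x : E) : T x = a (b x) := rfl
  have hTs (x y : E) : ⟪T x, y⟫ = ⟪x, T y⟫ := by rw [hTa, hTa, has, hbs, hab]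
  have hTT (x : E) : T (T x) = D (D x) := by
    rw [hDD, hTa, hTa, ← hab, haa, hbb]
  have hnorm (x : E) : ‖D x‖ = ‖T x‖ := by
    rw [← sq_eq_sq₀ (norm_nonneg _) (norm_nonneg _), @norm_sq_eq_re_inner ℂ,
      @norm_sq_eq_re_inner ℂ, hTs, hTT]
    exact hDs _ _
  have hTd : DenseRange T := dense_of_symm T (T.range.restrictScalars ℝ) (fun x => ⟨x, rfl⟩)
    (fun x y => congr(($(hTs x y)).re)) (fun x h => hbi x (hai _ h))
  have had : DenseRange a := dense_of_symm a (a.range.restrictScalars ℝ) (fun x => ⟨x, rfl⟩)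
    (fun x y => congr(($(has x y)).re)) hai
  have hDd : DenseRange D := dense_of_symm D (D.range.restrictScalars ℝ) (fun x => ⟨x, rfl⟩)
    hDs (fun x h => H.diffProj_injective h)
  set J0 := D.extendOfNorm T.toLinearMap with hJ0
  have hJT (x : E) : J0 (T x) = D x :=
    LinearMap.extendOfNorm_eq (e := T.toLinearMap) hTd ⟨1, fun x => by simp [hnorm]⟩ x
  have hJn (x : E) : ‖J0 x‖ = ‖x‖ :=
    hTd.induction_on x (isClosed_eq (by fun_prop) (by fun_prop))
      (fun y => by rw [hJT, hnorm])
  let J1 : E →ₗᵢ⋆[ℂ] E := ⟨J0.toLinearMap, hJn⟩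
  have hJs : Function.Surjective J1 := by
    have h1 : IsClosed (Set.range J1) := J1.isometry.isClosedEmbedding.isClosed_range
    have h2 : DenseRange J1 := hDd.mono (by
      rintro _ ⟨x, rfl⟩
      exact ⟨T x, hJT x⟩)
    intro y
    have : y ∈ closure (Set.range J1) := h2 y
    rwa [h1.closure_eq] at this
  let J : E ≃ₗᵢ⋆[ℂ] E := LinearIsometryEquiv.ofSurjective J1 hJs
  have hJ (x : E) : J (T x) = D x := hJT x
  have hDc : Continuous D := ((proj K).continuous.sub (proj K.mulI).continuous)
  have hTJ (w : E) : T (J.symm w) = D w :=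
    hDd.induction_on w (isClosed_eq (by fun_prop) hDc)
      (fun y => by rw [← hJ, J.symm_apply_apply, hTT, hJ])
  let A : E →ₗ.[ℂ] E := ⟨a.range, b.toLinearMap ∘ₗ
    (LinearEquiv.ofInjective a.toLinearMap ((injective_iff_map_eq_zero a).2 hai)).symm⟩
  have hAg (x z : E) : (x, z) ∈ A.graph ↔ ∃ y, x = a y ∧ z = b y := by
    have h (y : E) (hy : a y ∈ a.range) : A ⟨a y, hy⟩ = b y := by
      change b ((LinearEquiv.ofInjective a.toLinearMap _).symm ⟨a y, hy⟩) = b y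
      congr 1
      rw [LinearEquiv.symm_apply_eq]
      rfl
    rw [LinearPMap.mem_graph_iff]
    constructor
    · rintro ⟨⟨_, y, rfl⟩, rfl, hz⟩
      exact ⟨y, rfl, hz.symm.trans (h y _)⟩
    · rintro ⟨y, rfl, rfl⟩
      exact ⟨⟨a y, y, rfl⟩, rfl, h y _⟩
  -- Solving `a y = u`, `b y = v`.
  have hsolve (u v : E) (h : a v = b u) : ∃ y, u = a y ∧ v = b y := by
    refine ⟨(2⁻¹ : ℂ) • (a u + b v), ?_, ?_⟩
    · rw [map_smul, map_add, hab, h, haa, hbb, hR2a, add_sub_cancel, inv_smul_smul₀ two_ne_zero]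
    · rw [map_smul, map_add, ← hab, ← h, haa, hbb, hR2a, add_sub_cancel,
        inv_smul_smul₀ two_ne_zero]
  have hAd : Dense (A.domain : Set E) := had
  refine ⟨J, A, ?_, ?_, ?_⟩
  · rw [LinearPMap.isSelfAdjoint_def]
    apply le_antisymm
    · apply LinearPMap.le_of_le_graph
      rintro ⟨u, v⟩ huv
      rw [hAg]
      obtain ⟨⟨u, hu⟩, rfl, rfl⟩ := (LinearPMap.mem_graph_iff _).1 huv
      apply hsolve
      refine ext_inner_right ℂ fun y => ?_
      have hy : (a y, b y) ∈ A.graph := (hAg _ _).2 ⟨y, rfl, rfl⟩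
      obtain ⟨z, hz1, hz2⟩ := (LinearPMap.mem_graph_iff _).1 hy
      have := A.adjoint_isFormalAdjoint hAd ⟨u, hu⟩ z
      simp only [hz1, hz2] at this
      rw [has, hbs, this]
    · refine LinearPMap.IsFormalAdjoint.le_adjoint hAd fun x y => ?_
      obtain ⟨x', hx, hx'⟩ := (hAg _ _).1 (A.mem_graph x)
      obtain ⟨y', hy, hy'⟩ := (hAg _ _).1 (A.mem_graph y)
      rw [hx, hx', hy, hy', hbs, has, hab]
  · intro x
    obtain ⟨y, hx, hz⟩ := (hAg x (A x)).1 (A.mem_graph x)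
    rw [hx, hz, has, ← hTa, ← hTs]
    exact ((ContinuousLinearMap.nonneg_iff_isPositive T).1 hT_pos).2 y
  · intro x y
    rw [mem_tomita_graph]
    simp only [hAg]
    constructor
    · rintro ⟨h, hh, k, hk, rfl, rfl⟩
      have h1 : D (h - k) = R2 (h + k) := by
        rw [hR2a]
        simp only [hD, hR, diffProj_apply, sumProj_apply, map_add, map_sub, two_smul,
          proj_eq K hh, proj_eq K.mulI hk]
        abel
      refine ⟨J.symm (h - k), hsolve _ _ ?_, (J.apply_symm_apply _).symm⟩
      rw [← hTJ, hTa, hab, ← hbb, ← sub_eq_zero, ← map_sub] at h1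
      exact sub_eq_zero.1 (hbi _ h1)
    · rintro ⟨z, ⟨y0, rfl, rfl⟩, rfl⟩
      have h2 (w : E) : J (b (a w)) = D w := by rw [← hab, ← hTa, hJ]
      have hp : a y0 + J (b y0) ∈ K := by
        refine had.induction_on (p := fun y => a y + J (b y) ∈ K) y0
          (K.isClosed.preimage (by fun_prop)) fun w => ?_
        rw [haa, h2, hR, hD, sumProj_apply, diffProj_apply, add_add_sub_cancel]
        exact add_mem (proj_mem K w) (proj_mem K w)
      have hm : a y0 - J (b y0) ∈ K.mulI := by
        refine had.induction_on (p := fun y => a y - J (b y) ∈ K.mulI) y0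
          (K.mulI.isClosed.preimage (by fun_prop)) fun w => ?_
        rw [haa, h2, hR, hD, sumProj_apply, diffProj_apply, add_sub_sub_cancel]
        exact add_mem (proj_mem K.mulI w) (proj_mem K.mulI w)
      refine ⟨(2⁻¹ : ℝ) • (a y0 + J (b y0)), SMulMemClass.smul_mem _ hp,
        (2⁻¹ : ℝ) • (a y0 - J (b y0)), SMulMemClass.smul_mem _ hm, ?_, ?_⟩
      · rw [← smul_add, add_add_sub_cancel, ← two_smul ℝ, inv_smul_smul₀ two_ne_zero]
      · rw [← smul_sub, add_sub_sub_cancel, ← two_smul ℝ, inv_smul_smul₀ two_ne_zero]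

/-- The modular conjugation `J_H`: the antiunitary factor of the polar decomposition
`S_H = J_H Δ_H^{1/2}` of the Tomita operator. -/
noncomputable def modularConjugation (H : StandardSubspace E) : E ≃ₗᵢ⋆[ℂ] E :=
  H.exists_isModularPair.choose

/-- The square root `Δ_H^{1/2}` of the modular operator: the positive factor of the polar
decomposition `S_H = J_H Δ_H^{1/2}` of the Tomita operator. -/
noncomputable def sqrtModularOperator (H : StandardSubspace E) : E →ₗ.[ℂ] E :=
  H.exists_isModularPair.choose_spec.choose

theorem isModularPair (H : StandardSubspace E) :
    H.IsModularPair H.modularConjugation H.sqrtModularOperator :=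
  H.exists_isModularPair.choose_spec.choose_spec

/-- `U^# = J_H U^* J_H` for a unitary `U`. -/
noncomputable def sharp (H : StandardSubspace E) (U : E ≃ₗᵢ[ℂ] E) : E ≃ₗᵢ[ℂ] E :=
  (H.modularConjugation.trans U.symm).trans H.modularConjugation

/-- A unitary `U` is symmetric (relative to `H`) if `U = U^#`. -/
def IsSymmetricUnitary (H : StandardSubspace E) (U : E ≃ₗᵢ[ℂ] E) : Prop :=
  U = H.sharp U

/-- `H` is a factor if `H ∩ H' = {0}`. -/
def IsFactor (H : StandardSubspace E) : Prop :=
  H.toClosedSubmodule ⊓ H.toClosedSubmodule.symplComp = ⊥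

end StandardSubspace

namespace StandardSubspace
variable {E : Type*} [NormedAddCommGroup E] [InnerProductSpace ℂ E]

/-! Two facts carry the theorem. The first is superadditivity (`rank_compl_mul`). Let `c` be the
real orthogonal or the symplectic complement, with `H ∩ c(H) = 0`. For endomorphisms `U`, `W` the
spaces `c(UH) ∩ H` and `U(c(WH) ∩ H)` both lie in `c(UWH) ∩ H`, and they meet inside `U(H ∩ c(H)) =
0`, so dimensions add along products. For the orthogonal complement this is (a), since each proper
endomorphism contributes at least 1.

The second is `rank_orthogonal_le_rank_symplComp`: for a symmetric endomorphism `V`, `dim((VH)^⊥ ∩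
H) ≤ dim((V²H)' ∩ H)`. With `C = 1 + J` and `k` the component of `Ch` orthogonal to `C(VH)`, the
injection is `h ↦ V(ik)`. The vector `k` is fixed by `J`, hence orthogonal to `VH` itself, so `ik ∈
(VH)'` and `V(ik) ∈ (V²H)'`. Symmetry of `V` gives `V(ik) = -J V*(ik)`, which lies in `JH' ⊆ H`.
Injectivity and closedness of `C(VH)` hold because `C` is bounded below on `H`.

Then (b) is superadditivity for the symplectic complement, and (c) applies the inequality to
`U(x/2)`, whose orthogonal codimension is infinite by (a) because it is an arbitrarily high power.
-/

/-! ### Antiunitaries, unitary images and complements -/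

theorem inner_map_map_antiunitary (J : E ≃ₗᵢ⋆[ℂ] E) (x y : E) : ⟪J x, J y⟫ = ⟪y, x⟫ := by
  have hre (x y : E) : (⟪J x, J y⟫).re = (⟪y, x⟫).re := by
    have h1 := norm_add_sq (𝕜 := ℂ) (J x) (J y)
    have h2 := norm_add_sq (𝕜 := ℂ) x y
    rw [← map_add, J.norm_map, J.norm_map, J.norm_map] at h1
    have h3 : (⟪x, y⟫).re = (⟪y, x⟫).re := inner_re_symm (𝕜 := ℂ) x y
    simp only [RCLike.re_to_complex] at h1 h2
    linarith
  apply Complex.ext (hre x y)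
  have := hre (Complex.I • x) y
  rw [map_smulₛₗ, inner_smul_left, inner_smul_right] at this
  simpa using this

theorem inner_antiunitary_left (J : E ≃ₗᵢ⋆[ℂ] E) (x y : E) : ⟪J x, y⟫ = ⟪J.symm y, x⟫ := by
  rw [← inner_map_map_antiunitary J.symm, J.symm_apply_apply]

theorem inner_antiunitary_right (J : E ≃ₗᵢ⋆[ℂ] E) (x y : E) : ⟪x, J y⟫ = ⟪y, J.symm x⟫ := by
  rw [← inner_map_map_antiunitary J.symm, J.symm_apply_apply]

theorem mem_unitaryImage {U : E ≃ₗᵢ[ℂ] E} {K : ClosedSubmodule ℝ E} {x : E} :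
    x ∈ unitaryImage U K ↔ U.symm x ∈ K :=
  ClosedSubmodule.mem_mapEquiv_iff (U.toContinuousLinearEquiv.restrictScalars ℝ) _ x

theorem apply_mem_unitaryImage {U : E ≃ₗᵢ[ℂ] E} {K : ClosedSubmodule ℝ E} {x : E} :
    U x ∈ unitaryImage U K ↔ x ∈ K := by
  rw [mem_unitaryImage, U.symm_apply_apply]

theorem unitaryImage_mul (U V : E ≃ₗᵢ[ℂ] E) (K : ClosedSubmodule ℝ E) :
    unitaryImage (U * V) K = unitaryImage U (unitaryImage V K) := by
  ext x
  exact (mem_unitaryImage.trans (mem_unitaryImage.trans mem_unitaryImage).symm)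

theorem unitaryImage_mono (U : E ≃ₗᵢ[ℂ] E) {K L : ClosedSubmodule ℝ E} (h : K ≤ L) :
    unitaryImage U K ≤ unitaryImage U L :=
  fun _ hx => mem_unitaryImage.2 (h (mem_unitaryImage.1 hx))

theorem inner_unitary_symm (U : E ≃ₗᵢ[ℂ] E) (x y : E) : ⟪x, U.symm y⟫ = ⟪U x, y⟫ := by
  rw [← U.inner_map_map, U.apply_symm_apply]

theorem mem_orthogonal_iff {K : ClosedSubmodule ℝ E} {x : E} :
    x ∈ Kᗮ ↔ ∀ y ∈ K, (⟪y, x⟫).re = 0 :=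
  Submodule.mem_orthogonal _ _

theorem unitaryImage_orthogonal (U : E ≃ₗᵢ[ℂ] E) (K : ClosedSubmodule ℝ E) :
    unitaryImage U Kᗮ = (unitaryImage U K)ᗮ := by
  refine SetLike.ext fun x => ?_
  rw [mem_unitaryImage, mem_orthogonal_iff, mem_orthogonal_iff]
  refine ⟨fun h y hy => ?_, fun h y hy => ?_⟩
  · rw [← U.symm.inner_map_map]
    exact h _ (mem_unitaryImage.1 hy)
  · rw [inner_unitary_symm]
    exact h _ (apply_mem_unitaryImage.2 hy)

theorem unitaryImage_symplComp (U : E ≃ₗᵢ[ℂ] E) (K : ClosedSubmodule ℝ E) :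
    unitaryImage U K.symplComp = (unitaryImage U K).symplComp := by
  refine SetLike.ext fun x => ?_
  rw [mem_unitaryImage, mem_symplComp_iff, mem_symplComp_iff]
  refine ⟨fun h y hy => ?_, fun h y hy => ?_⟩
  · rw [← U.symm.inner_map_map]
    exact h _ (mem_unitaryImage.1 hy)
  · rw [inner_unitary_symm]
    exact h _ (apply_mem_unitaryImage.2 hy)

theorem unitaryImage_inf (U : E ≃ₗᵢ[ℂ] E) (K L : ClosedSubmodule ℝ E) :
    unitaryImage U (K ⊓ L) = unitaryImage U K ⊓ unitaryImage U L :=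
  SetLike.ext fun _ => by simp only [mem_unitaryImage, ClosedSubmodule.mem_inf]

theorem rank_unitaryImage (U : E ≃ₗᵢ[ℂ] E) (K : ClosedSubmodule ℝ E) :
    Module.rank ℝ (unitaryImage U K).toSubmodule = Module.rank ℝ K.toSubmodule :=
  ((U.toLinearEquiv.restrictScalars ℝ).submoduleMap K.toSubmodule).rank_eq.symm

theorem orthogonal_antitone {K L : ClosedSubmodule ℝ E} (h : K ≤ L) : Lᗮ ≤ Kᗮ :=
  fun _ hx => mem_orthogonal_iff.2 fun y hy => mem_orthogonal_iff.1 hx y (h hy)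

theorem symplComp_antitone {K L : ClosedSubmodule ℝ E} (h : K ≤ L) : L.symplComp ≤ K.symplComp :=
  fun _ hx => mem_symplComp_iff.2 fun y hy => mem_symplComp_iff.1 hx y (h hy)

/-! ### Superadditivity of codimension along products -/

theorem add_rank_le {K L M : ClosedSubmodule ℝ E} (hK : K ≤ M) (hL : L ≤ M) (h : K ⊓ L = ⊥) :
    Module.rank ℝ K.toSubmodule + Module.rank ℝ L.toSubmodule ≤ Module.rank ℝ M.toSubmodule := by
  have h' : K.toSubmodule ⊓ L.toSubmodule = ⊥ := congrArg ClosedSubmodule.toSubmodule h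
  rw [← Submodule.rank_sup_add_rank_inf_eq, h', rank_bot, add_zero]
  exact Submodule.rank_mono (sup_le hK hL)

theorem one_le_rank {K : ClosedSubmodule ℝ E} (h : K ≠ ⊥) :
    1 ≤ Module.rank ℝ K.toSubmodule := by
  rw [Cardinal.one_le_iff_ne_zero, Ne, rank_zero_iff, Submodule.subsingleton_iff_eq_bot]
  exact fun h' => h (ClosedSubmodule.toSubmodule_injective h')

/-- A complement operation that is equivariant, antitone and trivially meets its argument makes
codimensions of nested images superadditive. -/
theorem rank_compl_mul (c : ClosedSubmodule ℝ E → ClosedSubmodule ℝ E)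
    (hc : ∀ U K, unitaryImage U (c K) = c (unitaryImage U K)) (ha : ∀ {K L}, K ≤ L → c L ≤ c K)
    {H : ClosedSubmodule ℝ E} (h0 : H ⊓ c H = ⊥) {U W : E ≃ₗᵢ[ℂ] E}
    (hU : unitaryImage U H ≤ H) (hW : unitaryImage W H ≤ H) :
    Module.rank ℝ (c (unitaryImage U H) ⊓ H).toSubmodule +
      Module.rank ℝ (c (unitaryImage W H) ⊓ H).toSubmodule ≤
    Module.rank ℝ (c (unitaryImage (U * W) H) ⊓ H).toSubmodule := by
  rw [← rank_unitaryImage U (c (unitaryImage W H) ⊓ H), unitaryImage_inf, hc, unitaryImage_mul]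
  apply add_rank_le
  -- The summands are now `c(UH) ∩ H` and `c(UWH) ∩ UH`.
  · exact inf_le_inf_right _ (ha (unitaryImage_mono U hW))
  · exact inf_le_inf_left _ hU
  · rw [eq_bot_iff]
    have h1 : unitaryImage U (H ⊓ c H) ≤ ⊥ := by
      rw [h0]
      intro x hx
      rw [mem_unitaryImage, ClosedSubmodule.mem_bot] at hx
      exact (U.symm.map_eq_zero_iff).1 hx
    rw [unitaryImage_inf, hc] at h1
    exact fun x hx => h1 ⟨hx.2.2, hx.1.1⟩

theorem length_le_rank_compl (c : ClosedSubmodule ℝ E → ClosedSubmodule ℝ E)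
    (hc : ∀ U K, unitaryImage U (c K) = c (unitaryImage U K)) (ha : ∀ {K L}, K ≤ L → c L ≤ c K)
    {H : ClosedSubmodule ℝ E} (h0 : H ⊓ c H = ⊥) (l : List (E ≃ₗᵢ[ℂ] E))
    (hl : ∀ U ∈ l, unitaryImage U H ≤ H ∧
      1 ≤ Module.rank ℝ (c (unitaryImage U H) ⊓ H).toSubmodule) :
    unitaryImage l.prod H ≤ H ∧
      (l.length : Cardinal) ≤ Module.rank ℝ (c (unitaryImage l.prod H) ⊓ H).toSubmodule := by
  induction l with
  | nil => exact ⟨fun x hx => mem_unitaryImage.1 hx, by simp⟩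
  | cons U l ih =>
    obtain ⟨h1, h2⟩ := ih fun V hV => hl V (List.mem_cons_of_mem _ hV)
    obtain ⟨h3, h4⟩ := hl U List.mem_cons_self
    rw [List.prod_cons]
    refine ⟨?_, ?_⟩
    · rw [unitaryImage_mul]
      exact (unitaryImage_mono U h1).trans h3
    · refine le_trans ?_ (rank_compl_mul c hc ha h0 h3 h1)
      rw [List.length_cons, Nat.cast_succ, add_comm]
      exact add_le_add h4 h2

theorem inf_orthogonal_self (K : ClosedSubmodule ℝ E) : K ⊓ Kᗮ = ⊥ :=
  ClosedSubmodule.toSubmodule_injective (Submodule.inf_orthogonal_eq_bot K.toSubmodule)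

variable [CompleteSpace E]

theorem orthogonal_inf_ne_bot {K L : ClosedSubmodule ℝ E} (h : K < L) : Kᗮ ⊓ L ≠ ⊥ := by
  obtain ⟨x, hx, hxK⟩ := SetLike.exists_of_lt h
  intro h0
  have h1 : x - proj K x ∈ Kᗮ ⊓ L := by
    refine ⟨mem_orthogonal_iff.2 fun y hy => ?_, sub_mem hx (h.le (proj_mem K x))⟩
    rw [← inner_conj_symm, Complex.conj_re]
    exact proj_sub K x hy
  rw [h0, ClosedSubmodule.mem_bot, sub_eq_zero] at h1
  exact hxK (h1 ▸ proj_mem K x)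

theorem length_le_rank_orthogonal (H : StandardSubspace E) (l : List (E ≃ₗᵢ[ℂ] E))
    (hl : ∀ U ∈ l, H.IsProperEndomorphism U) :
    (l.length : Cardinal) ≤ Module.rank ℝ
      ((unitaryImage l.prod H.toClosedSubmodule)ᗮ ⊓ H.toClosedSubmodule).toSubmodule :=
  (length_le_rank_compl (fun K => Kᗮ) unitaryImage_orthogonal orthogonal_antitone
    (inf_orthogonal_self _) l fun U hU =>
      ⟨(hl U hU).le, one_le_rank (orthogonal_inf_ne_bot (hl U hU))⟩).2

/-! ### Modular theory: `J² = 1`, `JH' ⊆ H`, positivity on `H` -/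

namespace IsModularPair
variable {H : StandardSubspace E} {J : E ≃ₗᵢ⋆[ℂ] E} {A : E →ₗ.[ℂ] E}

/-- `J ∘ A` sends `h + k` to `h - k` for `h ∈ H` and `k ∈ iH`. -/
theorem add_mem_graph (hJA : H.IsModularPair J A) {h k : E} (hh : h ∈ H.toClosedSubmodule)
    (hk : k ∈ H.toClosedSubmodule.mulI) : (h + k, J.symm (h - k)) ∈ A.graph := by
  obtain ⟨z, hz, hz'⟩ :=
    (hJA.graph_eq (h + k) (h - k)).1 (H.mem_tomita_graph.2 ⟨h, hh, k, hk, rfl, rfl⟩)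
  rwa [hz', J.symm_apply_apply]

theorem exists_of_mem_graph (hJA : H.IsModularPair J A) {x z : E} (h : (x, z) ∈ A.graph) :
    ∃ h ∈ H.toClosedSubmodule, ∃ k ∈ H.toClosedSubmodule.mulI, x = h + k ∧ J z = h - k :=
  H.mem_tomita_graph.1 ((hJA.graph_eq x (J z)).2 ⟨z, h, rfl⟩)

theorem inner_symm_graph (hJA : H.IsModularPair J A) {x y x' y' : E} (h : (x, y) ∈ A.graph)
    (h' : (x', y') ∈ A.graph) : ⟪y, x'⟫ = ⟪x, y'⟫ := by
  obtain ⟨u, rfl, rfl⟩ := (LinearPMap.mem_graph_iff _).1 h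
  obtain ⟨v, rfl, rfl⟩ := (LinearPMap.mem_graph_iff _).1 h'
  have hsa := hJA.isSelfAdjoint
  have := LinearPMap.adjoint_isFormalAdjoint hsa.dense_domain
  rw [LinearPMap.isSelfAdjoint_def.1 hsa] at this
  exact this u v

theorem nonneg_graph (hJA : H.IsModularPair J A) {x y : E} (h : (x, y) ∈ A.graph) :
    0 ≤ (⟪x, y⟫).re := by
  obtain ⟨u, rfl, rfl⟩ := (LinearPMap.mem_graph_iff _).1 h
  exact hJA.nonneg u

/-- Membership in the graph of the selfadjoint factor may be tested on `H`. -/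
theorem mem_graph_of_forall (hJA : H.IsModularPair J A) {x y : E}
    (h : ∀ g ∈ H.toClosedSubmodule, ⟪y, g⟫ = ⟪x, J.symm g⟫) : (x, y) ∈ A.graph := by
  have hsa := hJA.isSelfAdjoint
  have hz : ∀ z : A.domain, ⟪y, (z : E)⟫ = ⟪x, A z⟫ := by
    intro z
    obtain ⟨g, hg, k, hk, h1, h2⟩ := hJA.exists_of_mem_graph (A.mem_graph z)
    rw [mem_mulI_iff] at hk
    have hk' := h _ hk
    rw [map_smulₛₗ, inner_smul_right, inner_smul_right] at hk'
    -- Antilinearity of `J` carries the hypothesis from `H` to `iH` with a change of sign, matching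
    -- `A(g + k) = J⁻¹(g - k)`.
    have hk2 : ⟪y, k⟫ = - ⟪x, J.symm k⟫ := by
      apply mul_left_cancel₀ Complex.I_ne_zero
      simpa using hk'
    rw [← J.symm_apply_apply (A z), h2, h1, map_sub, inner_add_right, inner_sub_right, h g hg, hk2,
      sub_eq_add_neg]
  have hd : x ∈ A.adjoint.domain := LinearPMap.mem_adjoint_domain_of_exists x ⟨y, hz⟩
  have := LinearPMap.adjoint_apply_eq hsa.dense_domain ⟨x, hd⟩ hz
  have hm : (x, y) ∈ A.adjoint.graph := (LinearPMap.mem_graph_iff _).2 ⟨⟨x, hd⟩, rfl, this⟩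
  rwa [LinearPMap.isSelfAdjoint_def.1 hsa] at hm

/-- The antiunitary factor of the Tomita operator is an involution. -/
theorem involutive (hJA : H.IsModularPair J A) (x : E) : J (J x) = x := by
  set K := H.toClosedSubmodule with hK
  set R := sumProj K with hR
  set D := diffProj K with hD
  have hDc : Continuous D := ((proj K).continuous.sub (proj K.mulI).continuous)
  -- `D = JT` will be the polar decomposition of the bounded operator `D`. As `D` is real-symmetric,
  -- uniqueness of positive square roots makes `J` and `T` commute, which forces `J = J⁻¹`.
  let T : E →L[ℂ] E :=
    { toFun := fun x => J.symm (D x)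
      map_add' := fun x y => by rw [map_add, map_add]
      map_smul' := fun c x => by simp [map_smulₛₗ]
      cont := J.symm.continuous.comp hDc }
  have hT (x : E) : T x = J.symm (D x) := rfl
  have hJT (x : E) : J (T x) = D x := J.apply_symm_apply _
  have hRT (x : E) : (R x, T x) ∈ A.graph := hJA.add_mem_graph (proj_mem K x) (proj_mem K.mulI x)
  have hT2 (x : E) : (T x, (2 : ℂ) • x - R x) ∈ A.graph := by
    apply hJA.mem_graph_of_forall
    -- The cases `k = 0` and `g = 0`, `k = ig` give the real and imaginary parts of the required
    -- identity.
    have hre : ∀ g ∈ K, ∀ k ∈ K.mulI,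
        (⟪(2 : ℂ) • x - R x, g + k⟫).re = (⟪T x, J.symm (g - k)⟫).re := by
      intro g hg k hk
      rw [hT, inner_map_map_antiunitary J.symm, ← inner_conj_symm (g - k), Complex.conj_re]
      have h1 := proj_sub K x hg
      have h2 := proj_sub K.mulI x hk
      simp only [hR, hD, sumProj_apply, diffProj_apply, two_smul, inner_sub_left, inner_sub_right,
        inner_add_left, inner_add_right, Complex.add_re, Complex.sub_re] at h1 h2 ⊢
      linarith
    intro g hg
    apply Complex.ext
    · have := hre g hg 0 (zero_mem _)
      simpa using this
    · have := hre 0 (zero_mem _) (Complex.I • g) (by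
        rw [mem_mulI_iff, smul_smul, Complex.I_mul_I, neg_smul, one_smul]; exact (Submodule.neg_mem_iff K.toSubmodule).2 hg)
      rw [zero_add, zero_sub, map_neg, map_smulₛₗ, inner_smul_right, inner_neg_right,
        inner_smul_right] at this
      simpa only [Complex.conj_I, neg_mul, Complex.I_mul_re, neg_neg, neg_inj] using this
  -- Symmetry of `A` on the two families of graph vectors `(Rx, Tx)` and `(Tx, 2x - Rx)`: the terms
  -- in `R` cancel on combining. Positivity of `T` follows from the same two families.
  have hTs (x y : E) : ⟪T x, y⟫ = ⟪x, T y⟫ := by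
    have h1 := hJA.inner_symm_graph (hRT x) (hRT y)
    have h2 := hJA.inner_symm_graph (hT2 x) (hT2 y)
    rw [inner_sub_left, inner_sub_right, inner_smul_left, inner_smul_right, Complex.conj_ofNat,
      h1, sub_left_inj] at h2
    exact (mul_left_cancel₀ two_ne_zero h2).symm
  have hTp (x : E) : 0 ≤ (⟪T x, x⟫).re := by
    have h1 := hJA.nonneg_graph (hRT x)
    have h2 := hJA.nonneg_graph (hT2 x)
    rw [inner_sub_right, inner_smul_right, ← inner_conj_symm (T x) (R x)] at h2
    simp only [Complex.sub_re, Complex.mul_re, Complex.re_ofNat, Complex.im_ofNat,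
      Complex.conj_re] at h2
    linarith
  -- The real adjoint of `D = JT`.
  have hTJ (w : E) : T (J.symm w) = D w := by
    refine ext_inner_right ℝ fun y => ?_
    rw [inner_real_eq_re_inner, inner_real_eq_re_inner, diffProj_symm, hTs, hT,
      inner_map_map_antiunitary J.symm, ← inner_conj_symm, Complex.conj_re]
  let Q : E →L[ℂ] E :=
    { toFun := fun x => J (T (J.symm x))
      map_add' := fun x y => by simp
      map_smul' := fun c x => by simp [map_smulₛₗ]
      cont := by fun_prop }
  have hQ (x : E) : Q x = J (T (J.symm x)) := rfl
  have hQT : Q = T := by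
    have hT0 : 0 ≤ T := isPositive_of_re T (fun x y => congr(($(hTs x y)).re)) hTp
    have hQ0 : 0 ≤ Q := by
      refine isPositive_of_re Q (fun x y => ?_) (fun x => ?_)
      · rw [hQ, hQ, inner_antiunitary_left, inner_antiunitary_right, hTs]
      · rw [hQ, inner_antiunitary_left, ← hTs]
        exact hTp _
    -- From `JT = D = TJ⁻¹`: both squares equal `D²`.
    have hQQ : Q * Q = T * T := by
      ext x
      change Q (Q x) = T (T x)
      rw [hQ, hQ, J.symm_apply_apply, hJT, hTJ, ← hJT x, ← hTJ, J.symm_apply_apply]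
    rw [← CFC.sqrt_unique hQQ hQ0, CFC.sqrt_unique rfl hT0]
  have hTi (x : E) (h : T x = 0) : x = 0 :=
    H.diffProj_injective (by rw [← hK, ← hD, ← hJT, h, map_zero])
  have h1 : T (J x) = T (J.symm x) := by
    rw [← hQT, hQ, J.symm_apply_apply, hJT, hQT, hTJ]
  have h2 : J x = J.symm x := by
    rw [← sub_eq_zero]
    exact hTi _ (by rw [map_sub, h1, sub_self])
  rw [h2, J.apply_symm_apply]

/-- `J` maps the symplectic complement of `H` into `H`. -/
theorem apply_mem (hJA : H.IsModularPair J A) {v : E} (hv : v ∈ H.toClosedSubmodule.symplComp) :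
    J v ∈ H.toClosedSubmodule := by
  have hs (x : E) : J.symm x = J x := by rw [J.symm_apply_eq, hJA.involutive]
  -- For `v ∈ H'` all `⟪v, g⟫` with `g ∈ H` are real, which is the graph criterion. Then `S_H` fixes
  -- `Jv`, and its fixed points form `H`.
  have hg : (J v, v) ∈ A.graph := by
    apply hJA.mem_graph_of_forall
    intro g hg
    rw [hs, inner_map_map_antiunitary, ← inner_conj_symm v g, Complex.conj_eq_iff_im]
    exact mem_symplComp_iff.1 hv g hg
  obtain ⟨h, hh, k, hk, h1, h2⟩ := hJA.exists_of_mem_graph hg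
  have h3 : k = 0 := by
    rw [h1, sub_eq_add_neg, add_right_inj] at h2
    have h4 : (2 : ℝ) • k = 0 := by rw [two_smul, ← eq_neg_iff_add_eq_zero, ← h2]
    exact (smul_eq_zero_iff_right two_ne_zero).1 h4
  rwa [h1, h3, add_zero]

/-- Since `S_H` fixes `h` and `J² = 1`, `Jh = Ah`; the claim is positivity of `A`. -/
theorem re_inner_nonneg (hJA : H.IsModularPair J A) {h : E} (hh : h ∈ H.toClosedSubmodule) :
    0 ≤ (⟪h, J h⟫).re := by
  have := hJA.nonneg_graph (hJA.add_mem_graph hh (zero_mem _))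
  rwa [add_zero, sub_zero, J.symm_apply_eq.2 (hJA.involutive h).symm] at this

end IsModularPair

/-- The operator `1 + J` is bounded below on `H`. -/
theorem IsModularPair.norm_le {H : StandardSubspace E} {J : E ≃ₗᵢ⋆[ℂ] E} {A : E →ₗ.[ℂ] E}
    (hJA : H.IsModularPair J A) {h : E} (hh : h ∈ H.toClosedSubmodule) : ‖h‖ ≤ ‖h + J h‖ := by
  have h1 := norm_add_sq (𝕜 := ℂ) h (J h)
  have h2 := hJA.re_inner_nonneg hh
  rw [J.norm_map, RCLike.re_to_complex] at h1
  rw [← pow_le_pow_iff_left₀ (norm_nonneg _) (norm_nonneg _) two_ne_zero]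
  nlinarith [sq_nonneg ‖h‖]

/-! ### From orthogonal to symplectic complements by symmetric endomorphisms -/

theorem IsSymmetricUnitary.apply_apply {H : StandardSubspace E} {V : E ≃ₗᵢ[ℂ] E}
    (hV : H.IsSymmetricUnitary V) (x : E) :
    V (H.modularConjugation x) = H.modularConjugation (V.symm x) := by
  conv_lhs => rw [hV]
  change H.modularConjugation (V.symm (H.modularConjugation (H.modularConjugation x))) = _
  rw [H.isModularPair.involutive]

/-- The codimension of `V H` in `H` is at most the dimension of `(V²H)' ∩ H`. -/
theorem rank_orthogonal_le_rank_symplComp (H : StandardSubspace E) {V : E ≃ₗᵢ[ℂ] E}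
    (hVH : H.IsEndomorphism V) (hV : H.IsSymmetricUnitary V) :
    Module.rank ℝ
      ((unitaryImage V H.toClosedSubmodule)ᗮ ⊓ H.toClosedSubmodule).toSubmodule ≤
    Module.rank ℝ ((unitaryImage (V ^ 2) H.toClosedSubmodule).symplComp ⊓
      H.toClosedSubmodule).toSubmodule := by
  set K := H.toClosedSubmodule with hK
  set J := H.modularConjugation with hJ
  have hJA := H.isModularPair
  let C : E →L[ℝ] E :=
    { toFun := fun x => x + J x
      map_add' := fun x y => by rw [map_add]; abel
      map_smul' := fun c x => by
        rw [← Complex.coe_smul c x, map_smulₛₗ, Complex.conj_ofReal, ← smul_add]; rfl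
      cont := by fun_prop }
  have hC (x : E) : C x = x + J x := rfl
  have hJC (x : E) : J (C x) = C x := by rw [hC, map_add, hJA.involutive, add_comm]
  let L := unitaryImage V K
  let F : L.toSubmodule →L[ℝ] E := C.comp L.toSubmodule.subtypeL
  -- A map bounded below on a complete space has closed range, so the projection onto `C(VH)` takes
  -- values of the form `Cw` with `w ∈ VH`.
  have hF : IsClosed (F.range : Set E) := by
    have : CompleteSpace L.toSubmodule := L.isClosed.completeSpace_coe
    have : AntilipschitzWith 1 F := F.antilipschitz_of_bound fun x => by
      rw [NNReal.coe_one, one_mul]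
      exact hJA.norm_le (hVH x.2)
    exact this.isClosed_range F.uniformContinuous
  let M : ClosedSubmodule ℝ E := ⟨F.range, hF⟩
  let f : (Lᗮ ⊓ K).toSubmodule →ₗ[ℝ] E :=
    { toFun := fun h => V (Complex.I • (C h - proj M (C h)))
      map_add' := fun x y => by
        rw [← map_add, ← smul_add, Submodule.coe_add, map_add, map_add, add_sub_add_comm]
      map_smul' := fun c x => by
        rw [Submodule.coe_smul, C.map_smul, (proj M).map_smul, ← smul_sub,
          smul_comm Complex.I c, RingHom.id_apply]
        exact (V.toLinearEquiv.restrictScalars ℝ).map_smul c _ }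
  have hf (h) : f h = V (Complex.I • (C h - proj M (C h))) := rfl
  have hmem (h) : f h ∈ ((unitaryImage (V ^ 2) K).symplComp ⊓ K).toSubmodule := by
    obtain ⟨w, hw⟩ : proj M (C h) ∈ F.range := proj_mem M (C h)
    set k := C h - proj M (C h) with hk
    have hJk : J k = k := by
      have : k = C (h - w) := by rw [hk, ← hw, map_sub]; rfl
      rw [this, hJC]
    have hkV (g : E) (hg : g ∈ K) : (⟪V g, k⟫).re = 0 := by
      -- Orthogonality to `C(Vg)`; as `Jk = k`, both of its terms have real part `Re⟪Vg, k⟫`.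
      have h1 : (⟪k, V g + J (V g)⟫).re = 0 :=
        proj_sub M (C h) (w := C (V g)) ⟨⟨V g, apply_mem_unitaryImage.2 hg⟩, rfl⟩
      have h2 : ⟪k, J (V g)⟫ = ⟪V g, k⟫ := by
        conv_lhs => rw [← hJk]
        exact inner_map_map_antiunitary J _ _
      rw [inner_add_right, h2, ← inner_conj_symm, Complex.add_re, Complex.conj_re] at h1
      linarith
    have hm (g : E) (hg : g ∈ K) : (⟪V g, Complex.I • k⟫).im = 0 := by
      rw [inner_smul_right]
      simpa using hkV g hg
    have hm' : Complex.I • k ∈ L.symplComp := mem_symplComp_iff.2 fun y hy => by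
      have := hm _ (mem_unitaryImage.1 hy)
      rwa [V.apply_symm_apply] at this
    rw [hf]
    refine ⟨?_, ?_⟩
    · change _ ∈ (unitaryImage (V ^ 2) K).symplComp
      rw [pow_two, unitaryImage_mul, ← unitaryImage_symplComp]
      exact apply_mem_unitaryImage.2 hm'
    -- The symmetry of `V` enters here: `J` negates `ik`, and `VJ = JV⁻¹`.
    · have h1 : V (Complex.I • k) = J (V.symm (-(Complex.I • k))) := by
        rw [← hV.apply_apply, ← hJ, map_neg, J.map_smulₛₗ, hJk, Complex.conj_I, neg_smul, neg_neg]
      rw [h1]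
      apply hJA.apply_mem
      rw [← unitaryImage_symplComp] at hm'
      rw [map_neg]
      exact (Submodule.neg_mem_iff _).2 (mem_unitaryImage.1 hm')
  have hinj : Function.Injective f := by
    rw [injective_iff_map_eq_zero]
    intro h h0
    rw [hf, V.map_eq_zero_iff, smul_eq_zero_iff_right Complex.I_ne_zero, sub_eq_zero] at h0
    obtain ⟨w, hw⟩ : proj M (C h) ∈ F.range := proj_mem M (C h)
    -- If `Ch = Cw` with `w ∈ VH`, the lower bound for `C` on `H` gives `h = w`, so `h ∈ VH ∩ (VH)^⊥
    -- = 0`.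
    have hwK : (h : E) - w ∈ K := sub_mem (H := K.toSubmodule) h.2.2 (hVH w.2)
    have h1 : C (h - w) = 0 := by
      rw [map_sub, sub_eq_zero, h0, ← hw]; rfl
    have h2 : (h : E) - w = 0 := by
      rw [← norm_le_zero_iff, ← norm_zero (E := E), ← h1]
      exact hJA.norm_le hwK
    have h3 : (h : E) ∈ L ⊓ Lᗮ := ⟨sub_eq_zero.1 h2 ▸ w.2, h.2.1⟩
    rw [inf_orthogonal_self, ClosedSubmodule.mem_bot] at h3
    exact Subtype.ext h3
  exact LinearMap.rank_le_of_injective (f.codRestrict _ hmem)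
    fun x y hxy => hinj (congrArg Subtype.val hxy)

/-! ### Products of squares and one-parameter groups -/

theorem length_le_rank_symplComp (H : StandardSubspace E) (hH : H.IsFactor)
    (l : List (E ≃ₗᵢ[ℂ] E))
    (hl : ∀ U ∈ l, (∃ V : E ≃ₗᵢ[ℂ] E, H.IsEndomorphism V ∧ H.IsSymmetricUnitary V ∧ U = V ^ 2) ∧
      unitaryImage U H.toClosedSubmodule ≠ H.toClosedSubmodule) :
    (l.length : Cardinal) ≤ Module.rank ℝ
      ((unitaryImage l.prod H.toClosedSubmodule).symplComp ⊓ H.toClosedSubmodule).toSubmodule := by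
  refine (length_le_rank_compl _ unitaryImage_symplComp symplComp_antitone hH l fun U hU => ?_).2
  obtain ⟨⟨V, hV, hVs, rfl⟩, hne⟩ := hl U hU
  refine ⟨?_, le_trans (one_le_rank (orthogonal_inf_ne_bot ?_))
    (H.rank_orthogonal_le_rank_symplComp hV hVs)⟩
  · rw [pow_two, unitaryImage_mul]
    exact (unitaryImage_mono V hV).trans hV
  -- `VH = H` would give `V²H = H`.
  · refine lt_of_le_of_ne hV fun h => hne ?_
    rw [pow_two, unitaryImage_mul, h, h]

theorem aleph0_le_rank_symplComp (H : StandardSubspace E) (U : ℝ → (E ≃ₗᵢ[ℂ] E))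
    (hadd : ∀ x y, U (x + y) = U x * U y) (hs : ∀ x, H.IsSymmetricUnitary (U x))
    (hp : ∀ x, 0 < x → H.IsProperEndomorphism (U x)) {x : ℝ} (hx : 0 < x) :
    Cardinal.aleph0 ≤ Module.rank ℝ
      (unitaryImage (U x) H.toClosedSubmodule.symplComp ⊓ H.toClosedSubmodule).toSubmodule := by
  have hpow (y : ℝ) (n : ℕ) : U ((n + 1 : ℕ) * y) = U y ^ (n + 1) := by
    induction n with
    | zero => simp
    | succ n ih => rw [pow_succ, ← ih, ← hadd]; congr 1; push_cast; ring
  rw [Cardinal.aleph0_le]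
  intro n
  have hx2 : 0 < x / 2 := half_pos hx
  have h2 : U x = U (x / 2) ^ 2 := by rw [pow_two, ← hadd, add_halves]
  rw [unitaryImage_symplComp, h2]
  refine le_trans ?_ (H.rank_orthogonal_le_rank_symplComp (hp _ hx2).le (hs _))
  have hn : (0 : ℝ) < (n + 1 : ℕ) := by positivity
  -- `U(x/2)` is a product of `n + 1` equal proper factors; `n + 1` keeps the divisor nonzero when
  -- `n = 0`.
  have h3 := H.length_le_rank_orthogonal (List.replicate (n + 1) (U (x / 2 / (n + 1 : ℕ))))
    fun V hV => by
      rw [List.eq_of_mem_replicate hV]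
      exact hp _ (by positivity)
  rw [List.prod_replicate, ← hpow, mul_div_cancel₀ _ hn.ne', List.length_replicate] at h3
  exact le_trans (by exact_mod_cast n.le_succ) h3

end StandardSubspace

theorem mainTheorem4 {E : Type*} [NormedAddCommGroup E] [InnerProductSpace ℂ E] [CompleteSpace E]
    [TopologicalSpace.SeparableSpace E] (H : StandardSubspace E) :
    -- products of symmetric proper endomorphisms: `dim ((UH)^⊥ ∩ H) ≥ n`
    (∀ (n : ℕ) (U : Fin n → (E ≃ₗᵢ[ℂ] E)),
      (∀ j, H.IsProperEndomorphism (U j) ∧ H.IsSymmetricUnitary (U j)) →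
      (n : Cardinal) ≤ Module.rank ℝ
        ((StandardSubspace.unitaryImage (List.ofFn U).prod H.toClosedSubmodule)ᗮ ⊓
          H.toClosedSubmodule).toSubmodule) ∧
    -- products of proper squares of symmetric endomorphisms: `dim ((UH)' ∩ H) ≥ n`
    (H.IsFactor → ∀ (n : ℕ) (U : Fin n → (E ≃ₗᵢ[ℂ] E)),
      (∀ j, (∃ V : E ≃ₗᵢ[ℂ] E, H.IsEndomorphism V ∧ H.IsSymmetricUnitary V ∧ U j = V ^ 2) ∧
        StandardSubspace.unitaryImage (U j) H.toClosedSubmodule ≠ H.toClosedSubmodule) →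
      (n : Cardinal) ≤ Module.rank ℝ
        ((StandardSubspace.unitaryImage (List.ofFn U).prod H.toClosedSubmodule).symplComp ⊓
          H.toClosedSubmodule).toSubmodule) ∧
    -- one-parameter groups: `dim (U(x)H' ∩ H) = ∞` for `x > 0`
    (∀ U : ℝ → (E ≃ₗᵢ[ℂ] E),
      (∀ x y, U (x + y) = U x * U y) →
      (∀ x, H.IsSymmetricUnitary (U x)) →
      (∀ x, 0 < x → H.IsProperEndomorphism (U x)) →
      ∀ x, 0 < x → Cardinal.aleph0 ≤ Module.rank ℝ
        (StandardSubspace.unitaryImage (U x) H.toClosedSubmodule.symplComp ⊓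
          H.toClosedSubmodule).toSubmodule) := by
  refine ⟨fun n U hU => ?_, fun hH n U hU => ?_, fun U hadd hs hp x hx =>
    H.aleph0_le_rank_symplComp U hadd hs hp hx⟩
  · have h := H.length_le_rank_orthogonal (List.ofFn U)
      ((List.forall_mem_ofFn_iff).2 fun j => (hU j).1)
    rwa [List.length_ofFn] at h
  · have h := H.length_le_rank_symplComp hH (List.ofFn U) ((List.forall_mem_ofFn_iff).2 hU)
    rwa [List.length_ofFn] at h
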